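/- Let $n\ge 1$, let $\mathbb{D}=\{z\in\mathbb{C}:|z|<1\}$ and $S^1=\{z\in\mathbb{C}:|z|=1\}$. For $\alpha_0,\dots,\alpha_{n-2}\in\mathbb{D}$ and $\alpha_{n-1}\in S^1$ (Verblunsky coefficients) put $\rho_k=\sqrt{1-|\alpha_k|^2}$, $$\Xi_k=\begin{bmatrix}\bar\alpha_k&\rho_k\\ \rho_k&-\alpha_k\end{bmatrix}\quad(0\le k\le n-2),\qquad \Xi_{-1}=[1],\qquad \Xi_{n-1}=[\bar\alpha_{n-1}],$$ and form the $n\times n$ block-diagonal matrices $\mathcal{L}=\operatorname{diag}(\Xi_0,\Xi_2,\Xi_4,\dots)$ and $\mathcal{M}=\operatorname{diag}(\Xi_{-1},\Xi_1,\Xi_3,\dots)$. The CMV matrix associated to $\alpha_0,\dots,\alpha_{n-1}$ is $\mathcal{C}=\mathcal{L}\mathcal{M}$. A complex $n\times n$ matrix $U$, with rows and columns numbered $1,\dots,n$, has CMV shape if, for every $m\ge 0$, the entries in rows $2m+1$ and $2m+2$ vanish outside columns $2m,\,2m+1,\,2m+2,\,2m+3$, and the entries in position $(2,1)$ and in positions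 $(2j-1,2j+1)$ and $(2j+2,2j)$, $j\ge 1$, are positive real numbers; here only rows, columns and positions that lie within the $n\times n$ matrix are considered. Let $U$ be an $n\times n$ unitary matrix in CMV shape. Then there is a unique $n$-tuple of Verblunsky coefficients $\alpha_0,\dots,\alpha_{n-2}\in\mathbb{D}$, $\alpha_{n-1}\in S^1$ such that $U$ is the CMV matrix associated to these coefficients. -/

import Mathlib

namespace CMV

/-- The `2 × 2` block `Ξ(a) = [[ā, ρ], [ρ, -a]]` with `ρ = √(1 - |a|²)`. -/
noncomputable def Xi (a : ℂ) : Matrix (Fin 2) (Fin 2) ℂ :=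
  !![star a, (Real.sqrt (1 - ‖a‖ ^ 2) : ℂ);
     (Real.sqrt (1 - ‖a‖ ^ 2) : ℂ), -a]

/-- `L = diag(Ξ₀, Ξ₂, Ξ₄, …)`. Indices start at `0`; the block `Ξ_{2m}` sits in the rows and columns
`2m, 2m+1`. For odd `n` the last block has only the row and column `n - 1`, where the entry is
the top left entry of `Ξ(α_{n-1})`, so that this block is the `1 × 1` matrix `[ᾱ_{n-1}]`. -/
noncomputable def matL {n : ℕ} (α : Fin n → ℂ) : Matrix (Fin n) (Fin n) ℂ :=
  Matrix.of fun i j =>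
    if (i : ℕ) / 2 = (j : ℕ) / 2 then
      Xi (α ⟨2 * ((i : ℕ) / 2), by omega⟩)
        ⟨(i : ℕ) % 2, by omega⟩ ⟨(j : ℕ) % 2, by omega⟩
    else 0

/-- `M = diag(Ξ₋₁, Ξ₁, Ξ₃, …)` with `Ξ₋₁ = [1]`. Indices start at `0`; the block `Ξ_{2m+1}` sits in
the rows and columns `2m+1, 2m+2`. For even `n` the last block has only the row and column
`n - 1`, so that it is the `1 × 1` matrix `[ᾱ_{n-1}]`. -/
noncomputable def matM {n : ℕ} (α : Fin n → ℂ) : Matrix (Fin n) (Fin n) ℂ :=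
  Matrix.of fun i j =>
    if (i : ℕ) = 0 ∧ (j : ℕ) = 0 then 1
    else if h : 0 < (i : ℕ) ∧ 0 < (j : ℕ) ∧ ((i : ℕ) - 1) / 2 = ((j : ℕ) - 1) / 2 then
      Xi (α ⟨2 * (((i : ℕ) - 1) / 2) + 1, by omega⟩)
        ⟨((i : ℕ) - 1) % 2, by omega⟩ ⟨((j : ℕ) - 1) % 2, by omega⟩
    else 0

/-- The CMV matrix `L M` associated to the coefficients `α₀, …, α_{n-1}`. -/
noncomputable def cmvMatrix {n : ℕ} (α : Fin n → ℂ) : Matrix (Fin n) (Fin n) ℂ :=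
  matL α * matM α

/-- Verblunsky coefficients: `α₀, …, α_{n-2}` lie in the open unit disk, and `α_{n-1}` lies on the
unit circle. -/
def IsVerblunsky {n : ℕ} (α : Fin n → ℂ) : Prop :=
  (∀ k : Fin n, (k : ℕ) + 1 < n → ‖α k‖ < 1) ∧
  (∀ k : Fin n, (k : ℕ) + 1 = n → ‖α k‖ = 1)

/-- The entry `z` is a positive real number. -/
def IsPos (z : ℂ) : Prop := 0 < z.re ∧ z.im = 0

/-- CMV shape, with indices starting at `0`. The rows `2m, 2m+1` vanish outside of the columns
`2m-1, …, 2m+2`, and the exposed entries, in the positions `(1, 0)`, `(2m, 2m+2)` and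
`(2m+3, 2m+1)` with `m ≥ 0`, are positive wherever these positions lie in the matrix. -/
structure HasCMVShape {n : ℕ} (U : Matrix (Fin n) (Fin n) ℂ) : Prop where
  zero_left : ∀ i j : Fin n, (j : ℕ) + 1 < 2 * ((i : ℕ) / 2) → U i j = 0
  zero_right : ∀ i j : Fin n, 2 * ((i : ℕ) / 2) + 2 < (j : ℕ) → U i j = 0
  pos_first : ∀ i j : Fin n, (i : ℕ) = 1 → (j : ℕ) = 0 → IsPos (U i j)
  pos_upper : ∀ i j : Fin n, Even (i : ℕ) → (j : ℕ) = (i : ℕ) + 2 → IsPos (U i j)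
  pos_lower : ∀ i j : Fin n, Odd (j : ℕ) → (i : ℕ) = (j : ℕ) + 2 → IsPos (U i j)

end CMV

namespace CMV

/-! Induction on the size, peeling off one coefficient at a time. Dropping `α 0` turns odd blocks
into even ones, so `M(α) = 1 ⊕ L(tail)` and `L(α) = (Ξ(α₀) ⊕ 1)(1 ⊕ M(tail))`. As `L` and `M` are
symmetric, `M(tail) L(tail)` is the transpose of the smaller CMV matrix, which gives
`cmvMatrix_eq_padOne_mul`.

Conversely, the first column of a unitary `U` in CMV shape is `(ā, ρ, 0, …)` with `ρ > 0`, and it is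
also the first column of `Ξ(a) ⊕ 1`. Removing this factor leaves a unitary matrix with first column
`e₀`, hence `1 ⊕ Vᵀ`, and `V` again has CMV shape (`exists_eq_padOne_mul`). Uniqueness follows since
`U 0 0` determines `a`, and then `V` by cancellation. -/

open Matrix

/-- The block diagonal matrix `1 ⊕ A`. -/
def onePad {n : ℕ} (A : Matrix (Fin n) (Fin n) ℂ) : Matrix (Fin (n + 1)) (Fin (n + 1)) ℂ :=
  fun i j => Fin.cases (Fin.cases 1 (fun _ => 0) j) (fun i' => Fin.cases 0 (fun j' => A i' j') j) i

@[simp]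
theorem onePad_zero_zero {n : ℕ} (A : Matrix (Fin n) (Fin n) ℂ) : onePad A 0 0 = 1 := rfl

@[simp]
theorem onePad_zero_succ {n : ℕ} (A : Matrix (Fin n) (Fin n) ℂ) (j : Fin n) :
    onePad A 0 j.succ = 0 := rfl

@[simp]
theorem onePad_succ_zero {n : ℕ} (A : Matrix (Fin n) (Fin n) ℂ) (i : Fin n) :
    onePad A i.succ 0 = 0 := rfl

@[simp]
theorem onePad_succ_succ {n : ℕ} (A : Matrix (Fin n) (Fin n) ℂ) (i j : Fin n) :
    onePad A i.succ j.succ = A i j := rfl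

@[simp]
theorem onePad_one_zero {n : ℕ} (A : Matrix (Fin (n + 1)) (Fin (n + 1)) ℂ) :
    onePad A 1 0 = 0 := rfl

@[simp]
theorem onePad_zero_one {n : ℕ} (A : Matrix (Fin (n + 1)) (Fin (n + 1)) ℂ) :
    onePad A 0 1 = 0 := rfl

@[simp]
theorem onePad_one_one {n : ℕ} (A : Matrix (Fin (n + 1)) (Fin (n + 1)) ℂ) :
    onePad A 1 1 = A 0 0 := rfl

@[simp]
theorem onePad_one_succ {n : ℕ} (A : Matrix (Fin (n + 1)) (Fin (n + 1)) ℂ) (j : Fin (n + 1)) :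
    onePad A 1 j.succ = A 0 j := rfl

theorem onePad_mul {n : ℕ} (A B : Matrix (Fin n) (Fin n) ℂ) :
    onePad A * onePad B = onePad (A * B) := by
  ext i j
  rw [mul_apply, Fin.sum_univ_succ]
  refine Fin.cases ?_ (fun i => ?_) i <;> refine Fin.cases ?_ (fun j => ?_) j <;>
    simp [mul_apply]

theorem onePad_conjTranspose {n : ℕ} (A : Matrix (Fin n) (Fin n) ℂ) :
    (onePad A)ᴴ = onePad Aᴴ := by
  ext i j
  refine Fin.cases ?_ (fun i => ?_) i <;> refine Fin.cases ?_ (fun j => ?_) j <;>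
    simp [conjTranspose_apply]

theorem onePad_one {n : ℕ} : onePad (1 : Matrix (Fin n) (Fin n) ℂ) = 1 := by
  ext i j
  refine Fin.cases ?_ (fun i => ?_) i <;> refine Fin.cases ?_ (fun j => ?_) j <;>
    simp [one_apply, Fin.ext_iff]

theorem onePad_injective {n : ℕ} :
    Function.Injective (onePad : Matrix (Fin n) (Fin n) ℂ → _) := by
  intro A B h
  ext i j
  simpa using congrFun (congrFun h i.succ) j.succ

/-- The block diagonal matrix `B ⊕ 1` with a `2 × 2` block `B`. -/
def padOne (n : ℕ) (B : Matrix (Fin 2) (Fin 2) ℂ) : Matrix (Fin (n + 2)) (Fin (n + 2)) ℂ :=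
  fun i j =>
    if h : (i : ℕ) < 2 ∧ (j : ℕ) < 2 then B ⟨i, h.1⟩ ⟨j, h.2⟩ else if i = j then 1 else 0

theorem padOne_mul_apply_zero {n : ℕ} (B : Matrix (Fin 2) (Fin 2) ℂ)
    (X : Matrix (Fin (n + 2)) (Fin (n + 2)) ℂ) (j : Fin (n + 2)) :
    (padOne n B * X) 0 j = B 0 0 * X 0 j + B 0 1 * X 1 j := by
  rw [mul_apply, Fin.sum_univ_succ, Fin.sum_univ_succ]
  simp [padOne, Fin.ext_iff]

theorem padOne_mul_apply_one {n : ℕ} (B : Matrix (Fin 2) (Fin 2) ℂ)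
    (X : Matrix (Fin (n + 2)) (Fin (n + 2)) ℂ) (j : Fin (n + 2)) :
    (padOne n B * X) 1 j = B 1 0 * X 0 j + B 1 1 * X 1 j := by
  rw [mul_apply, Fin.sum_univ_succ, Fin.sum_univ_succ]
  simp [padOne, Fin.ext_iff]

theorem padOne_mul_apply_succ_succ {n : ℕ} (B : Matrix (Fin 2) (Fin 2) ℂ)
    (X : Matrix (Fin (n + 2)) (Fin (n + 2)) ℂ) (i : Fin n) (j : Fin (n + 2)) :
    (padOne n B * X) i.succ.succ j = X i.succ.succ j := by
  rw [mul_apply, Finset.sum_eq_single i.succ.succ]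
  · simp [padOne]
  · intro k _ hk
    simp [padOne, hk.symm]
  · simp

theorem padOne_mul {n : ℕ} (B C : Matrix (Fin 2) (Fin 2) ℂ) :
    padOne n B * padOne n C = padOne n (B * C) := by
  ext i j
  refine Fin.cases ?_ (fun i => Fin.cases ?_ (fun i => ?_) i) i
  · rw [padOne_mul_apply_zero]
    by_cases hj : (j : ℕ) < 2
    · simp [padOne, hj, mul_apply]
    · have h0 : (0 : Fin (n + 2)) ≠ j := by rintro rfl; simp at hj
      have h1 : (1 : Fin (n + 2)) ≠ j := by rintro rfl; simp at hj
      simp [padOne, hj, h0, h1]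
  · rw [Fin.succ_zero_eq_one, padOne_mul_apply_one]
    by_cases hj : (j : ℕ) < 2
    · simp [padOne, hj, mul_apply]
    · have h0 : (0 : Fin (n + 2)) ≠ j := by rintro rfl; simp at hj
      have h1 : (1 : Fin (n + 2)) ≠ j := by rintro rfl; simp at hj
      simp [padOne, hj, h0, h1]
  · rw [padOne_mul_apply_succ_succ]
    simp [padOne]

theorem padOne_one {n : ℕ} : padOne n 1 = 1 := by
  ext i j
  by_cases h : (i : ℕ) < 2 ∧ (j : ℕ) < 2 <;> simp [padOne, h, one_apply, Fin.ext_iff]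

theorem padOne_conjTranspose {n : ℕ} (B : Matrix (Fin 2) (Fin 2) ℂ) :
    (padOne n B)ᴴ = padOne n Bᴴ := by
  ext i j
  simp only [padOne, conjTranspose_apply]
  by_cases h : (i : ℕ) < 2 ∧ (j : ℕ) < 2
  · rw [dif_pos h, dif_pos h.symm]
  · rw [dif_neg h, dif_neg (fun h' => h h'.symm)]
    by_cases hij : i = j
    · rw [if_pos hij, if_pos hij.symm, star_one]
    · rw [if_neg hij, if_neg (Ne.symm hij), star_zero]

/-! ### Unitarity and symmetry of the blocks -/

theorem ofReal_sqrt_mul_self {a : ℂ} (ha : ‖a‖ ≤ 1) :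
    (Real.sqrt (1 - ‖a‖ ^ 2) : ℂ) * (Real.sqrt (1 - ‖a‖ ^ 2) : ℂ) = 1 - star a * a := by
  have h : 0 ≤ 1 - ‖a‖ ^ 2 := by nlinarith [norm_nonneg a]
  rw [← Complex.ofReal_mul, Real.mul_self_sqrt h]
  have := Complex.conj_mul' a
  simp only [Complex.star_def, this]
  push_cast
  ring

theorem Xi_conjTranspose_mul_self {a : ℂ} (ha : ‖a‖ ≤ 1) : (Xi a)ᴴ * Xi a = 1 := by
  have h := ofReal_sqrt_mul_self ha
  simp only [Complex.star_def] at h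
  ext i j
  fin_cases i <;> fin_cases j <;>
    simp [Xi, mul_apply, conjTranspose_apply, one_apply, h] <;> ring

theorem Xi_transpose (a : ℂ) : (Xi a)ᵀ = Xi a := by
  ext i j
  fin_cases i <;> fin_cases j <;> simp [Xi]

theorem Xi_symm (a : ℂ) (i j : Fin 2) : Xi a i j = Xi a j i :=
  congrFun (congrFun (Xi_transpose a) j) i

theorem padOne_Xi_conjTranspose_mul_self (n : ℕ) {a : ℂ} (ha : ‖a‖ ≤ 1) :
    (padOne n (Xi a))ᴴ * padOne n (Xi a) = 1 := by
  rw [padOne_conjTranspose, padOne_mul, Xi_conjTranspose_mul_self ha, padOne_one]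

theorem matL_transpose {n : ℕ} (α : Fin n → ℂ) : (matL α)ᵀ = matL α := by
  ext i j
  by_cases h : (i : ℕ) / 2 = (j : ℕ) / 2
  · simp only [matL, transpose_apply, of_apply, h]
    simp [Xi_symm _ _ (⟨(i : ℕ) % 2, by omega⟩ : Fin 2)]
  · simp [matL, h, Ne.symm h]

theorem matM_transpose {n : ℕ} (α : Fin n → ℂ) : (matM α)ᵀ = matM α := by
  ext i j
  simp only [matM, transpose_apply, of_apply]
  by_cases h0 : (i : ℕ) = 0 ∧ (j : ℕ) = 0
  · rw [if_pos h0, if_pos h0.symm]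
  · rw [if_neg h0, if_neg (fun h => h0 h.symm)]
    by_cases h : 0 < (i : ℕ) ∧ 0 < (j : ℕ) ∧ ((i : ℕ) - 1) / 2 = ((j : ℕ) - 1) / 2
    · rw [dif_pos h, dif_pos ⟨h.2.1, h.1, h.2.2.symm⟩, Xi_symm]
      simp only [h.2.2]
    · rw [dif_neg h, dif_neg (fun h' => h ⟨h'.2.1, h'.1, h'.2.2.symm⟩)]

theorem matM_eq_onePad {n : ℕ} (α : Fin (n + 1) → ℂ) :
    matM α = onePad (matL (Fin.tail α)) := by
  ext i j
  refine Fin.cases ?_ (fun i => ?_) i <;> refine Fin.cases ?_ (fun j => ?_) j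
  · simp [matM]
  · simp [matM]
  · simp [matM]
  · by_cases h : (i : ℕ) / 2 = (j : ℕ) / 2 <;> simp [matM, matL, Fin.tail, h]

/-- By `matM_eq_onePad`, the second factor is the identity on the first two coordinates and carries
`Ξ₂, Ξ₄, …` on the others. -/
theorem matL_eq_padOne_mul {n : ℕ} (α : Fin (n + 2) → ℂ) :
    matL α = padOne n (Xi (α 0)) * onePad (matM (Fin.tail α)) := by
  rw [matM_eq_onePad]
  ext i j
  refine Fin.cases ?_ (fun i => Fin.cases ?_ (fun i => ?_) i) i
  · rw [padOne_mul_apply_zero]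
    refine Fin.cases ?_ (fun j => Fin.cases ?_ (fun j => ?_) j) j
    · simp [matL]
    · simp [matL]
    · simp only [onePad_zero_succ, onePad_one_succ]
      simp [matL, Nat.add_assoc]
  · rw [Fin.succ_zero_eq_one, padOne_mul_apply_one]
    refine Fin.cases ?_ (fun j => Fin.cases ?_ (fun j => ?_) j) j
    · simp [matL]
    · simp [matL]
    · simp only [onePad_zero_succ, onePad_one_succ]
      simp [matL, Nat.add_assoc]
  · rw [padOne_mul_apply_succ_succ]
    refine Fin.cases ?_ (fun j => Fin.cases ?_ (fun j => ?_) j) j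
    · simp [matL]
    · rw [onePad_succ_succ, onePad_succ_zero]
      simp [matL]
    · rw [onePad_succ_succ, onePad_succ_succ]
      simp [matL, Fin.tail, Nat.add_assoc, Nat.mul_add]

/-- Splitting off the first Verblunsky coefficient from a CMV matrix. -/
theorem cmvMatrix_eq_padOne_mul {n : ℕ} (α : Fin (n + 2) → ℂ) :
    cmvMatrix α = padOne n (Xi (α 0)) * onePad (cmvMatrix (Fin.tail α))ᵀ := by
  rw [cmvMatrix, cmvMatrix, transpose_mul, matL_transpose, matM_transpose, ← onePad_mul,
    ← matM_eq_onePad α, ← Matrix.mul_assoc, ← matL_eq_padOne_mul]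

/-! ### Peeling a coefficient off a unitary matrix -/

theorem IsPos.eq_ofReal {z : ℂ} (h : IsPos z) : z = (z.re : ℂ) :=
  Complex.ext rfl (by simpa using h.2)

theorem isPos_of_mul {r : ℝ} (hr : 0 < r) {z : ℂ} (h : IsPos ((r : ℂ) * z)) : IsPos z := by
  obtain ⟨h1, h2⟩ := h
  simp only [Complex.re_ofReal_mul, Complex.im_ofReal_mul] at h1 h2
  exact ⟨(pos_iff_pos_of_mul_pos h1).1 hr, (mul_eq_zero.1 h2).resolve_left hr.ne'⟩

/-- Column `0` is `e₀`, and orthogonality of the other columns to it kills the rest of row `0`. -/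
theorem eq_onePad_of_unitary {n : ℕ} {W : Matrix (Fin (n + 1)) (Fin (n + 1)) ℂ}
    (hW : Wᴴ * W = 1) (h0 : W 0 0 = 1) (hs : ∀ i : Fin n, W i.succ 0 = 0) :
    W = onePad (W.submatrix Fin.succ Fin.succ) := by
  have hr : ∀ j : Fin n, W 0 j.succ = 0 := by
    intro j
    have h := congrFun (congrFun hW j.succ) 0
    rw [mul_apply, Fin.sum_univ_succ] at h
    simpa [conjTranspose_apply, h0, hs, one_apply, Fin.ext_iff] using h
  ext i j
  refine Fin.cases ?_ (fun i => ?_) i <;> refine Fin.cases ?_ (fun j => ?_) j <;>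
    simp [h0, hs, hr]

/-- A unitary matrix in CMV shape is `(Ξ(a) ⊕ 1) (1 ⊕ Vᵀ)` with `V` unitary in CMV shape. -/
theorem exists_eq_padOne_mul {n : ℕ} {U : Matrix (Fin (n + 2)) (Fin (n + 2)) ℂ}
    (hU : U ∈ Matrix.unitaryGroup (Fin (n + 2)) ℂ) (hshape : HasCMVShape U) :
    ∃ (a : ℂ) (V : Matrix (Fin (n + 1)) (Fin (n + 1)) ℂ), ‖a‖ < 1 ∧
      V ∈ Matrix.unitaryGroup (Fin (n + 1)) ℂ ∧ HasCMVShape V ∧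
      U = padOne n (Xi a) * onePad Vᵀ := by
  have hUU : Uᴴ * U = 1 := mem_unitaryGroup_iff'.1 hU
  have hp : IsPos (U 1 0) := hshape.pos_first 1 0 (by simp) (by simp)
  have hz : ∀ i : Fin n, U i.succ.succ 0 = 0 := fun i =>
    hshape.zero_left _ _ (by simp only [Fin.val_succ, Fin.val_zero]; omega)
  obtain ⟨r, hr, hr0⟩ : ∃ r : ℝ, U 1 0 = r ∧ 0 < r := ⟨_, hp.eq_ofReal, hp.1⟩
  set a : ℂ := star (U 0 0) with ha
  -- The first column is a unit vector with only two entries that can be nonzero.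
  have hcol : ‖a‖ ^ 2 + r ^ 2 = 1 := by
    have h := congrFun (congrFun hUU 0) 0
    rw [mul_apply, Fin.sum_univ_succ, Fin.sum_univ_succ] at h
    simp only [conjTranspose_apply, Fin.succ_zero_eq_one, hz, hr, one_apply_eq, mul_zero,
      Finset.sum_const_zero, add_zero, Complex.star_def, Complex.conj_mul',
      Complex.conj_ofReal] at h
    rw [ha, norm_star]
    have h' : ((‖U 0 0‖ ^ 2 + r ^ 2 : ℝ) : ℂ) = (1 : ℝ) := by push_cast; rw [← h]; ring
    exact_mod_cast h'
  have ha1 : ‖a‖ < 1 := by nlinarith [norm_nonneg a, pow_pos hr0 2]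
  have hρ : Real.sqrt (1 - ‖a‖ ^ 2) = r := by
    rw [show 1 - ‖a‖ ^ 2 = r ^ 2 by linarith, Real.sqrt_sq hr0.le]
  have hE := padOne_Xi_conjTranspose_mul_self n ha1.le
  have hE' := mul_eq_one_comm.1 hE
  have hrr := ofReal_sqrt_mul_self ha1.le
  rw [hρ] at hrr
  have hU00 : U 0 0 = star a := by simp [ha]
  set W := (padOne n (Xi a))ᴴ * U with hWdef
  have hUW : U = padOne n (Xi a) * W := by
    rw [hWdef, ← Matrix.mul_assoc, hE', Matrix.one_mul]
  have hWW : Wᴴ * W = 1 := by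
    rw [hWdef, conjTranspose_mul, conjTranspose_conjTranspose, Matrix.mul_assoc,
      ← Matrix.mul_assoc (padOne n (Xi a)), hE', Matrix.one_mul, hUU]
  have hW00 : W 0 0 = 1 := by
    rw [hWdef, padOne_conjTranspose, padOne_mul_apply_zero, hU00, hr]
    simp only [Complex.star_def] at hrr
    simp [Xi, conjTranspose_apply, hρ, hrr]
    ring
  have hWs : ∀ i : Fin (n + 1), W i.succ 0 = 0 := by
    intro i
    refine Fin.cases ?_ (fun i => ?_) i
    · rw [Fin.succ_zero_eq_one, hWdef, padOne_conjTranspose, padOne_mul_apply_one, hU00, hr]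
      simp [Xi, conjTranspose_apply, hρ]
      ring
    · rw [hWdef, padOne_conjTranspose, padOne_mul_apply_succ_succ, hz]
  have hWp := eq_onePad_of_unitary hWW hW00 hWs
  set V := (W.submatrix Fin.succ Fin.succ)ᵀ with hV
  have hWV : W = onePad Vᵀ := hWp
  -- Off column `0`, `V` is `U` transposed and shifted by one. Column `0` of `V` is read off row `0`
  -- of `U`, up to the positive factor `r`. Transposing swaps the left and right zero conditions and
  -- the upper and lower positivity; the entry `(0, 2)` of `U` yields `pos_first`.
  have hVU : ∀ (i : Fin (n + 1)) (j : Fin n), V i j.succ = U j.succ.succ i.succ := by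
    intro i j
    rw [hUW, padOne_mul_apply_succ_succ]
    rfl
  have hV0 : ∀ i : Fin (n + 1), U 0 i.succ = r * V i 0 := by
    intro i
    rw [hUW, padOne_mul_apply_zero, hWV, onePad_zero_succ, onePad_one_succ]
    simp [Xi, hρ]
  have hr' : (r : ℂ) ≠ 0 := by exact_mod_cast hr0.ne'
  refine ⟨a, V, ha1, ?_, ⟨?_, ?_, ?_, ?_, ?_⟩, hWV ▸ hUW⟩
  · have h : Vᵀᴴ * Vᵀ = 1 := by
      apply onePad_injective
      rw [← onePad_mul, ← onePad_conjTranspose, ← hWV, hWW, onePad_one]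
    have h2 : (V * Vᴴ)ᵀ = 1 := by rw [transpose_mul]; exact h
    rw [mem_unitaryGroup_iff]
    exact transpose_eq_one.1 h2
  · intro i j
    refine Fin.cases (fun h => ?_) (fun j h => ?_) j
    · have : U 0 i.succ = 0 := hshape.zero_right _ _ (by
        simp only [Fin.val_succ, Fin.val_zero] at h ⊢; omega)
      rw [hV0] at this
      exact (mul_eq_zero.1 this).resolve_left hr'
    · rw [hVU]
      exact hshape.zero_right _ _ (by simp only [Fin.val_succ] at h ⊢; omega)
  · intro i j
    refine Fin.cases (fun h => ?_) (fun j h => ?_) j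
    · simp at h
    · rw [hVU]
      exact hshape.zero_left _ _ (by simp only [Fin.val_succ] at h ⊢; omega)
  · intro i j hi hj
    obtain rfl : j = 0 := Fin.ext hj
    apply isPos_of_mul hr0
    rw [← hV0]
    exact hshape.pos_upper _ _ (by simp) (by simp [hi])
  · intro i j
    refine Fin.cases (fun _ h => ?_) (fun j hi h => ?_) j
    · simp at h
    · rw [hVU]
      simp only [Fin.val_succ] at h
      exact hshape.pos_lower _ _ (by simpa using hi.add_one) (by simp only [Fin.val_succ]; omega)
  · intro i j
    refine Fin.cases (fun h _ => ?_) (fun j hj h => ?_) j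
    · simp at h
    · rw [hVU]
      refine hshape.pos_upper _ _ (by simpa using hj.add_one) ?_
      simp only [Fin.val_succ] at h ⊢
      omega

/-! ### The induction -/

theorem isVerblunsky_succ_iff {n : ℕ} (α : Fin (n + 2) → ℂ) :
    IsVerblunsky α ↔ ‖α 0‖ < 1 ∧ IsVerblunsky (Fin.tail α) := by
  simp [IsVerblunsky, Fin.forall_fin_succ (n := n + 1), Fin.tail, and_assoc]

theorem cmvMatrix_zero_zero {n : ℕ} (α : Fin (n + 2) → ℂ) : cmvMatrix α 0 0 = star (α 0) := by
  rw [cmvMatrix_eq_padOne_mul, padOne_mul_apply_zero]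
  simp [Xi]

theorem cmvMatrix_fin_one (α : Fin 1 → ℂ) : cmvMatrix α 0 0 = star (α 0) := by
  simp [cmvMatrix, mul_apply, matL, matM, Xi]

theorem existsUnique_cmvMatrix (n : ℕ) (U : Matrix (Fin (n + 1)) (Fin (n + 1)) ℂ)
    (hU : U ∈ Matrix.unitaryGroup (Fin (n + 1)) ℂ) (hshape : HasCMVShape U) :
    ∃! α : Fin (n + 1) → ℂ, IsVerblunsky α ∧ U = cmvMatrix α := by
  induction n with
  | zero =>
    refine ⟨fun _ => star (U 0 0), ⟨⟨fun k hk => ?_, fun k _ => ?_⟩, ?_⟩, ?_⟩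
    · omega
    · have h := congrFun (congrFun (mem_unitaryGroup_iff'.1 hU) 0) 0
      simp only [star_eq_conjTranspose, mul_apply, Fin.sum_univ_succ, conjTranspose_apply,
        Complex.star_def, Complex.conj_mul', Finset.univ_eq_empty, Finset.sum_empty, add_zero,
        one_apply_eq] at h
      rw [norm_star]
      have h' : ‖U 0 0‖ ^ 2 = 1 := by exact_mod_cast h
      exact (pow_eq_one_iff_of_nonneg (norm_nonneg _) two_ne_zero).1 h'
    · ext i j
      obtain rfl : i = 0 := Fin.ext (by omega)
      obtain rfl : j = 0 := Fin.ext (by omega)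
      rw [cmvMatrix_fin_one, star_star]
    · rintro β ⟨-, rfl⟩
      funext k
      obtain rfl : k = 0 := Fin.ext (by omega)
      rw [cmvMatrix_fin_one, star_star]
  | succ n ih =>
    obtain ⟨a, V, ha, hV, hVs, hUV⟩ := exists_eq_padOne_mul hU hshape
    obtain ⟨α, ⟨hα, hVα⟩, huniq⟩ := ih V hV hVs
    have hU0 : U 0 0 = star a := by
      rw [hUV, padOne_mul_apply_zero]
      simp [Xi]
    refine ⟨Fin.cons a α, ⟨?_, ?_⟩, ?_⟩
    · rw [isVerblunsky_succ_iff, Fin.tail_cons]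
      exact ⟨ha, hα⟩
    · rw [cmvMatrix_eq_padOne_mul, Fin.tail_cons, ← hVα]
      exact hUV
    · rintro β ⟨hβ, hUβ⟩
      have hβ0 : β 0 = a := by
        rw [hUβ, cmvMatrix_zero_zero] at hU0
        exact star_injective hU0
      -- Both factorizations of `U` now share the unitary left factor, which cancels.
      have hVβ : V = cmvMatrix (Fin.tail β) := by
        rw [cmvMatrix_eq_padOne_mul, hβ0, hUV] at hUβ
        have h := congrArg ((padOne n (Xi a))ᴴ * ·) hUβ
        simp only [← Matrix.mul_assoc, padOne_Xi_conjTranspose_mul_self n ha.le,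
          Matrix.one_mul] at h
        exact transpose_injective (onePad_injective h)
      rw [← huniq _ ⟨((isVerblunsky_succ_iff β).1 hβ).2, hVβ⟩, ← hβ0, Fin.cons_self_tail]

end CMV

theorem corollaryC (n : ℕ) (hn : 1 ≤ n) (U : Matrix (Fin n) (Fin n) ℂ)
    (hU : U ∈ Matrix.unitaryGroup (Fin n) ℂ) (hshape : CMV.HasCMVShape U) :
    ∃! α : Fin n → ℂ, CMV.IsVerblunsky α ∧ U = CMV.cmvMatrix α := by
  obtain ⟨m, rfl⟩ := Nat.exists_eq_add_of_le' hn
  exact CMV.existsUnique_cmvMatrix m U hU hshape
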